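/- Conventions. Each mode has two quadratures $(X,P)$; $J=\bigoplus_k J_1$ with $J_1=\begin{pmatrix}0&-1\\1&0\end{pmatrix}$ is the symplectic form. The covariance matrix (CM) of a pure $n$-mode Gaussian state is a real symmetric strictly positive $2n\times 2n$ matrix $\gamma$ with $\gamma+J\gamma^{-1}J=0$. For a three-mode CM let $\gamma_{ij}$ be the $2\times2$ block of covariances between the modes $i$ and $j$. A Gaussian operation on three modes is described, via the Choi–Jamiołkowski isomorphism, by a six-mode CM $\Gamma=\begin{pmatrix}\Gamma_1&\Gamma_{12}\\ \Gamma_{12}^T&\Gamma_2\end{pmatrix}$ (index 1: three output modes, index 2: three input modes), and maps $\gamma$ to $$\gamma'=\Gamma_1-\Gamma_{12}\,(\Gamma_2+\Lambda\gamma\Lambda)^{-1}\,\Gamma_{12}^T,\qquad \Lambda=\sigma_z\oplus\sigma_z\oplus\sigma_z .$$ It is a pure Gaussian LOCC (GLOCC) if $\Gamma=\bigoplus_{x=1}^3\Gamma_x$, where $\Gamma_x$ is a pure two-mode CM on the output and input modes of party $x$. It is a GLOCC if its Choi–Jamiołkowski state is separable over the three parties, i.e. $\Gamma\ge\bigoplus_{x=1}^3\Gamma_x$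 for some pure two-mode CMs $\Gamma_x$. We say that $\gamma$ can be transformed into $\gamma'$ by (pure) GLOCC if $\gamma'$ is an output, or a limit of outputs, of (pure) GLOCC applied to $\gamma$; the limits cover infinitely squeezed $\Gamma$, e.g. not acting on a mode. Lemma. Let $\gamma$ be the CM of a pure three-mode Gaussian state with $\det\gamma_{ij}\le 0$ for all $i\ne j$. 1. If $\gamma$ can be transformed into $\gamma'$ by pure GLOCC, then $\det\gamma'_{ij}\le 0$ for all $i\neq j$. 2. If $\gamma$ can be transformed into $\gamma'$ by GLOCC and $\gamma'$ is the CM of a pure state, then $\det\gamma'_{ij}\le0$ for all $i\ne j$. Consequence. For $\lambda\ge1$ let $\gamma_{\rm sym}(\lambda)$ be the symmetric (CV GHZ/W) state, with diagonal blocks $\lambda\mathbb 1$ and all off-diagonal blocks equal to $\mathrm{diag}(d^+,d^-)$, $d^\pm=\frac1{4\lambda}\bigl(\lambda^2-1\pm\sqrt{9\lambda^4-10\lambda^2+1}\bigr)$. For $s>0$ and $\theta\in\mathbb R$ with $\sin\theta\cos\theta\ne0$ let $$\gamma(s,\theta)=B(\theta)\,[\gamma_{\rm tms}(s)\oplus\mathbb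 1]\,B(\theta)^T,\quad \gamma_{\rm tms}(s)=\begin{pmatrix}\cosh s\,\mathbb 1&\sinh s\,\sigma_z\\ \sinh s\,\sigma_z&\cosh s\,\mathbb 1\end{pmatrix},\quad B(\theta)=\mathbb 1\oplus\begin{pmatrix}\cos\theta\,\mathbb 1&\sin\theta\,\mathbb 1\\-\sin\theta\,\mathbb 1&\cos\theta\,\mathbb 1\end{pmatrix}$$ be the distributed two-mode squeezed state. Then $\gamma(s,\theta)$ is the CM of a pure state, and no $\gamma_{\rm sym}(\lambda)$, $\lambda\ge 1$, can be transformed into it by GLOCC. In particular the symmetric states do not reach all pure three-mode Gaussian states. -/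

import Mathlib

open scoped Kronecker

noncomputable section

namespace GLOCC

/-- Pauli matrix `σ_z`. -/
def sigmaZ : Matrix (Fin 2) (Fin 2) ℝ := !![1, 0; 0, -1]

/-- The form `J = ⊕ J₁` over the set `M` of modes. A phase-space index is a pair
(mode, quadrature), the quadrature `0` being `X` and the quadrature `1` being `P`. -/
def sympJ (M : Type*) [DecidableEq M] : Matrix (M × Fin 2) (M × Fin 2) ℝ :=
  (1 : Matrix M M ℝ) ⊗ₖ !![0, -1; 1, 0]

/-- `γ` is the covariance matrix of a pure Gaussian state: it is real, symmetric, strictly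
positive, and the uncertainty relation `γ + J γ⁻¹ J ≥ 0` holds with equality. -/
def IsPureCM {M : Type*} [Fintype M] [DecidableEq M]
    (γ : Matrix (M × Fin 2) (M × Fin 2) ℝ) : Prop :=
  γ.PosDef ∧ γ + sympJ M * γ⁻¹ * sympJ M = 0

/-- The `2 × 2` block of covariances between the modes `i` and `j`. -/
def modeBlock {M : Type*} (γ : Matrix (M × Fin 2) (M × Fin 2) ℝ) (i j : M) :
    Matrix (Fin 2) (Fin 2) ℝ :=
  γ.submatrix (fun q => (i, q)) (fun q => (j, q))

/-- All off-diagonal blocks have non-positive determinant. -/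
def NonposDets {M : Type*} (γ : Matrix (M × Fin 2) (M × Fin 2) ℝ) : Prop :=
  ∀ i j, i ≠ j → (modeBlock γ i j).det ≤ 0

/-- Covariance matrices of three modes. -/
abbrev CM3 := Matrix (Fin 3 × Fin 2) (Fin 3 × Fin 2) ℝ

/-- Covariance matrices of two modes: mode `0` is the output port and mode `1` the input
port of one party. -/
abbrev LocalCJ := Matrix (Fin 2 × Fin 2) (Fin 2 × Fin 2) ℝ

/-- Choi–Jamiołkowski covariance matrices of operations on three modes: the six modes are
pairs (party, port), the port `0` being the output and the port `1` the input. -/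
abbrev CJ3 := Matrix ((Fin 3 × Fin 2) × Fin 2) ((Fin 3 × Fin 2) × Fin 2) ℝ

/-- The block `Γ_{ab}` of a Choi–Jamiołkowski covariance matrix between the three modes of
port `a` and the three modes of port `b`. -/
def portBlock (Γ : CJ3) (a b : Fin 2) : CM3 :=
  Γ.submatrix (fun k => ((k.1, a), k.2)) (fun k => ((k.1, b), k.2))

/-- `Λ = σ_z ⊕ σ_z ⊕ σ_z`. -/
def Lam : CM3 := (1 : Matrix (Fin 3) (Fin 3) ℝ) ⊗ₖ sigmaZ

/-- `γ' = Γ₁ - Γ₁₂ (Γ₂ + Λ γ Λ)⁻¹ Γ₁₂ᵀ`: the covariance matrix to which the operation with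
Choi–Jamiołkowski covariance matrix `Γ` takes `γ`. -/
def output (Γ : CJ3) (γ : CM3) : CM3 :=
  portBlock Γ 0 0 -
    portBlock Γ 0 1 * (portBlock Γ 1 1 + Lam * γ * Lam)⁻¹ * (portBlock Γ 0 1).transpose

/-- The direct sum `⊕_x G_x` over the three parties. -/
def localSum (G : Fin 3 → LocalCJ) : CJ3 :=
  Matrix.of fun k l => if k.1.1 = l.1.1 then G k.1.1 (k.1.2, k.2) (l.1.2, l.2) else 0

/-- Pure Gaussian LOCC: the Choi–Jamiołkowski state is a product, over the three parties, of
pure two-mode Gaussian states. -/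
def IsPureGLOCC (Γ : CJ3) : Prop :=
  ∃ G : Fin 3 → LocalCJ, (∀ x, IsPureCM (G x)) ∧ Γ = localSum G

/-- Gaussian LOCC, possibly mixed: the Choi–Jamiołkowski state is separable over the three
parties, i.e. a mixture of displaced pure product states, i.e. its covariance matrix
dominates that of a pure product state. -/
def IsGLOCC (Γ : CJ3) : Prop :=
  ∃ G : Fin 3 → LocalCJ, (∀ x, IsPureCM (G x)) ∧ (Γ - localSum G).PosSemidef

/-- Pure Gaussian LOCC takes `γ` to `γ'`. The closure adds the operations whose
Choi–Jamiołkowski state is infinitely squeezed, such as not acting on a mode. -/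
def PureReaches (γ γ' : CM3) : Prop :=
  γ' ∈ closure {δ | ∃ Γ, IsPureGLOCC Γ ∧ δ = output Γ γ}

/-- Gaussian LOCC takes `γ` to `γ'`, infinitely squeezed Choi–Jamiołkowski states included. -/
def Reaches (γ γ' : CM3) : Prop :=
  γ' ∈ closure {δ | ∃ Γ, IsGLOCC Γ ∧ δ = output Γ γ}

/-- The entries `d⁺` (for `ε = 1`) and `d⁻` (for `ε = -1`) of the symmetric state. -/
def symEntry (ε l : ℝ) : ℝ :=
  ((l ^ 2 - 1) + ε * √(9 * l ^ 4 - 10 * l ^ 2 + 1)) / (4 * l)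

/-- The symmetric (CV GHZ/W) state `γ_sym(l)`: diagonal blocks `l • 1`, off-diagonal blocks
`diag(d⁺, d⁻)`. -/
def symState (l : ℝ) : CM3 :=
  l • (1 : CM3) +
    !![0, 1, 1; 1, 0, 1; 1, 1, 0] ⊗ₖ !![symEntry 1 l, 0; 0, symEntry (-1) l]

/-- A two-mode squeezed vacuum of modes `0`, `1`, and mode `2` in the vacuum. -/
def tmsVacuum (s : ℝ) : CM3 :=
  !![Real.cosh s, 0, 0; 0, Real.cosh s, 0; 0, 0, 1] ⊗ₖ (1 : Matrix (Fin 2) (Fin 2) ℝ) +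
    !![0, Real.sinh s, 0; Real.sinh s, 0, 0; 0, 0, 0] ⊗ₖ sigmaZ

/-- A beam splitter on the modes `1`, `2`. -/
def beamSplitter (θ : ℝ) : CM3 :=
  !![1, 0, 0; 0, Real.cos θ, Real.sin θ; 0, -Real.sin θ, Real.cos θ] ⊗ₖ
    (1 : Matrix (Fin 2) (Fin 2) ℝ)

/-- The distributed two-mode squeezed state `γ(s, θ)`. -/
def distributedTMS (s θ : ℝ) : CM3 :=
  beamSplitter θ * tmsVacuum s * (beamSplitter θ).transpose

end GLOCC

end

namespace GLOCC

open Matrix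

/-! Mixed operations reduce to pure ones. The output is monotone in the Choi–Jamiołkowski matrix
(`posSemidef_output_sub`), so a GLOCC output dominates the output of a pure GLOCC, which is again
pure (`isPureCM_output`). Pure CMs are minimal (`IsPureCM.eq_of_posSemidef_sub`), so a pure state
that dominates a limit of pure outputs equals it (`Reaches.pureReaches`); a compactness argument
provides that limit.

For a pure GLOCC, the off-diagonal block of the output is `-Cᵢ (M⁻¹)ᵢⱼ Cⱼᵀ`, where `M = ΛγΛ + ⊕ Bₓ`
with `Bₓ` the input block of party `x` and `Cₓ` its output-input block. Since `det Cₓ ≤ 0` for every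
party, the claim becomes `det (M⁻¹)ᵢⱼ ≤ 0`. By Jacobi's identity this is the sign of a complementary
minor, which sees only the noise `B` on the third mode.

That minor is a polynomial in `B` (`det_fromBlocks_add`). For a pure state its constant term is `det
γᵢⱼ` and its quadratic term is `det γᵢⱼ * det B`, both non-positive by hypothesis. The linear term
is non-positive for every pure state, by the uncertainty relation (`IsPureCM.coefficient_nonpos`).

The symmetric states have `d⁺d⁻ ≤ 0`, whereas one block of the distributed squeezed state has a
positive determinant. -/

/-! ### Pure covariance matrices: symplectic form, uncertainty, minimality, closedness. -/

theorem sympJ_transpose {M : Type*} [DecidableEq M] : (sympJ M)ᵀ = -sympJ M := by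
  ext ⟨a, p⟩ ⟨b, q⟩
  by_cases hab : a = b
  · subst hab
    fin_cases p <;> fin_cases q <;> simp [sympJ]
  · simp [sympJ, hab, Ne.symm hab]

section Modes

variable {M : Type*} [Fintype M] [DecidableEq M]

theorem sympJ_mul_self : sympJ M * sympJ M = -1 := by
  have h : (!![0, -1; 1, 0] : Matrix (Fin 2) (Fin 2) ℝ) * !![0, -1; 1, 0] = -1 := by
    ext i j
    fin_cases i <;> fin_cases j <;> simp
  rw [sympJ, ← Matrix.mul_kronecker_mul, h, Matrix.one_mul]
  ext ⟨a, p⟩ ⟨b, q⟩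
  by_cases hab : a = b <;> by_cases hpq : p = q <;>
    simp [hab, hpq]

theorem isUnit_sympJ : IsUnit (sympJ M) :=
  IsUnit.of_mul_eq_one (-sympJ M) (by rw [Matrix.mul_neg, sympJ_mul_self, neg_neg])

theorem IsPureCM.mul_sympJ_mul {γ : Matrix (M × Fin 2) (M × Fin 2) ℝ} (h : IsPureCM γ) :
    γ * sympJ M * γ = sympJ M := by
  have hu : IsUnit γ.det := (Matrix.isUnit_iff_isUnit_det _).1 h.1.isUnit
  have h2 : γ = -(sympJ M * γ⁻¹ * sympJ M) := eq_neg_of_add_eq_zero_left h.2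
  calc γ * sympJ M * γ = -(sympJ M * γ⁻¹ * sympJ M) * sympJ M * γ := by rw [← h2]
    _ = -(sympJ M * γ⁻¹ * (sympJ M * sympJ M) * γ) := by
        simp only [Matrix.neg_mul, Matrix.mul_assoc]
    _ = sympJ M := by
        rw [sympJ_mul_self]
        simp only [Matrix.mul_neg, Matrix.mul_one, Matrix.neg_mul, neg_neg]
        rw [Matrix.mul_assoc, Matrix.nonsing_inv_mul _ hu, Matrix.mul_one]

theorem inv_eq_of_mul_sympJ_mul {γ : Matrix (M × Fin 2) (M × Fin 2) ℝ}
    (h : γ * sympJ M * γ = sympJ M) : γ⁻¹ = -(sympJ M * γ * sympJ M) := by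
  refine Matrix.inv_eq_right_inv ?_
  rw [Matrix.mul_neg, ← Matrix.mul_assoc, ← Matrix.mul_assoc, h, sympJ_mul_self, neg_neg]

/-- This form has no inverse and no strict inequality, so purity is visibly a closed condition and
passes to limits. -/
theorem isPureCM_iff {γ : Matrix (M × Fin 2) (M × Fin 2) ℝ} :
    IsPureCM γ ↔ γ.PosSemidef ∧ γ * sympJ M * γ = sympJ M := by
  refine ⟨fun h => ⟨h.1.posSemidef, h.mul_sympJ_mul⟩, fun ⟨h1, h2⟩ => ?_⟩
  have hu : IsUnit γ :=
    IsUnit.of_mul_eq_one (-(sympJ M * γ * sympJ M)) (by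
      rw [Matrix.mul_neg, ← Matrix.mul_assoc, ← Matrix.mul_assoc, h2, sympJ_mul_self, neg_neg])
  refine ⟨h1.posDef_iff_isUnit.2 hu, ?_⟩
  rw [inv_eq_of_mul_sympJ_mul h2]
  calc γ + sympJ M * -(sympJ M * γ * sympJ M) * sympJ M
      = γ - (sympJ M * sympJ M) * γ * (sympJ M * sympJ M) := by
        simp only [Matrix.mul_neg, Matrix.neg_mul, Matrix.mul_assoc, sub_eq_add_neg]
    _ = 0 := by rw [sympJ_mul_self]; simp

theorem IsPureCM.inv_eq {γ : Matrix (M × Fin 2) (M × Fin 2) ℝ} (h : IsPureCM γ) :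
    γ⁻¹ = -(sympJ M * γ * sympJ M) :=
  inv_eq_of_mul_sympJ_mul h.mul_sympJ_mul

theorem IsPureCM.transpose_eq {γ : Matrix (M × Fin 2) (M × Fin 2) ℝ} (h : IsPureCM γ) :
    γᵀ = γ := by
  simpa [Matrix.IsHermitian] using h.1.isHermitian

theorem IsPureCM.det_eq_one {γ : Matrix (M × Fin 2) (M × Fin 2) ℝ} (h : IsPureCM γ) :
    γ.det = 1 := by
  have h1 := congrArg Matrix.det h.mul_sympJ_mul
  rw [Matrix.det_mul, Matrix.det_mul] at h1
  have hJ : (sympJ M).det ≠ 0 := ((Matrix.isUnit_iff_isUnit_det _).1 isUnit_sympJ).ne_zero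
  have h2 : γ.det * γ.det = 1 := by
    apply mul_right_cancel₀ hJ
    linarith
  nlinarith [h.1.det_pos]

/-- The uncertainty relation `γ + iJ ≥ 0`, written for the real and imaginary parts. -/
theorem IsPureCM.uncertainty {γ : Matrix (M × Fin 2) (M × Fin 2) ℝ} (h : IsPureCM γ)
    (u v : M × Fin 2 → ℝ) :
    0 ≤ u ⬝ᵥ γ *ᵥ u + v ⬝ᵥ γ *ᵥ v + 2 * (u ⬝ᵥ sympJ M *ᵥ v) := by
  -- Since `γJγ = J`, the vector `Jγv` has the same `γ`-norm as `v`, and its `γ`-product with `u` is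
  -- `u · Jv`.
  have h0 := h.1.posSemidef.dotProduct_mulVec_nonneg (u + sympJ M *ᵥ (γ *ᵥ v))
  have hJ : γ *ᵥ (sympJ M *ᵥ (γ *ᵥ v)) = sympJ M *ᵥ v := by
    rw [Matrix.mulVec_mulVec, Matrix.mulVec_mulVec, h.mul_sympJ_mul]
  have e1 : (sympJ M *ᵥ (γ *ᵥ v)) ⬝ᵥ (γ *ᵥ u) = u ⬝ᵥ sympJ M *ᵥ v := by
    rw [← hJ, dotProduct_comm, Matrix.dotProduct_mulVec u γ, ← Matrix.mulVec_transpose,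
      h.transpose_eq]
  have e2 : (sympJ M *ᵥ (γ *ᵥ v)) ⬝ᵥ (sympJ M *ᵥ v) = v ⬝ᵥ γ *ᵥ v := by
    rw [Matrix.dotProduct_mulVec, ← Matrix.mulVec_transpose, sympJ_transpose,
      Matrix.mulVec_mulVec, Matrix.neg_mul, sympJ_mul_self, neg_neg, Matrix.one_mulVec,
      dotProduct_comm]
  rw [star_trivial, Matrix.mulVec_add, hJ, add_dotProduct, dotProduct_add, dotProduct_add,
    e1, e2] at h0
  linarith

theorem eq_zero_of_posSemidef_of_neg {n : Type*} [Fintype n] [DecidableEq n] {E : Matrix n n ℝ}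
    (h : E.PosSemidef) (h' : (-E).PosSemidef) : E = 0 := by
  have h1 := h.trace_nonneg
  have h2 := h'.trace_nonneg
  rw [Matrix.trace_neg] at h2
  exact h.trace_eq_zero_iff.1 (by linarith)

/-- The block matrix `(A, 1; 1, A⁻¹)` is positive semidefinite because one Schur complement
vanishes. Adding `B - A` to its corner and taking the other Schur complement gives the claim. -/
theorem posSemidef_inv_sub_inv {n : Type*} [Fintype n] [DecidableEq n] {A B : Matrix n n ℝ}
    (hA : A.PosDef) (hB : B.PosDef) (h : (B - A).PosSemidef) : (A⁻¹ - B⁻¹).PosSemidef := by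
  have := hA.isUnit.invertible
  have := hB.isUnit.invertible
  have := hA.inv.isUnit.invertible
  have h1 : (fromBlocks A 1 1ᴴ A⁻¹).PosSemidef := by
    rw [Matrix.PosDef.fromBlocks₂₂ _ _ hA.inv]
    simp [PosSemidef.zero]
  have h2 : (fromBlocks (B - A) 0 0ᴴ (0 : Matrix n n ℝ)).PosSemidef := by
    refine PosSemidef.of_dotProduct_mulVec_nonneg ?_ fun x => ?_
    · exact Matrix.IsHermitian.fromBlocks h.1 rfl isHermitian_zero
    · have := h.dotProduct_mulVec_nonneg (x ∘ Sum.inl)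
      simpa [dotProduct, mulVec, fromBlocks, Fintype.sum_sum_type] using this
  have h3 := h1.add h2
  rw [Matrix.fromBlocks_add] at h3
  simp only [add_sub_cancel, conjTranspose_zero, add_zero] at h3
  rw [Matrix.PosDef.fromBlocks₁₁ _ _ hB] at h3
  simpa using h3

/-- Pure covariance matrices are minimal. -/
theorem IsPureCM.eq_of_posSemidef_sub {p γ : Matrix (M × Fin 2) (M × Fin 2) ℝ} (hp : IsPureCM p)
    (hγ : IsPureCM γ) (h : (γ - p).PosSemidef) : γ = p := by
  -- Inversion reverses the order, but on pure CMs it is conjugation by `J` up to sign, which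
  -- preserves it; hence both `γ - p` and `p - γ` are positive semidefinite.
  have h1 := posSemidef_inv_sub_inv hp.1 hγ.1 h
  rw [hp.inv_eq, hγ.inv_eq] at h1
  have h2 := h1.mul_mul_conjTranspose_same (sympJ M)
  have e : sympJ M * (-(sympJ M * p * sympJ M) - -(sympJ M * γ * sympJ M)) * (sympJ M)ᴴ
      = -(γ - p) := by
    have : (sympJ M)ᴴ = -sympJ M := by simpa using sympJ_transpose (M := M)
    rw [this]
    calc _ = (sympJ M * sympJ M) * (p - γ) * (sympJ M * sympJ M) := by noncomm_ring
      _ = _ := by rw [sympJ_mul_self]; simp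
  rw [e] at h2
  exact sub_eq_zero.1 (eq_zero_of_posSemidef_of_neg h h2)

theorem isClosed_posSemidef {n : Type*} [Fintype n] :
    IsClosed {A : Matrix n n ℝ | A.PosSemidef} := by
  have : {A : Matrix n n ℝ | A.PosSemidef} =
      {A | Aᴴ = A} ∩ ⋂ x : n → ℝ, {A | 0 ≤ star x ⬝ᵥ A *ᵥ x} := by
    ext A
    simp [Matrix.posSemidef_iff_dotProduct_mulVec, Matrix.IsHermitian]
  rw [this]
  refine (isClosed_eq (by fun_prop) continuous_id).inter (isClosed_iInter fun x => ?_)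
  exact isClosed_le continuous_const (by fun_prop)

theorem isClosed_isPureCM : IsClosed {γ : Matrix (M × Fin 2) (M × Fin 2) ℝ | IsPureCM γ} := by
  simp only [isPureCM_iff]
  exact isClosed_posSemidef.inter (isClosed_eq (by fun_prop) continuous_const)

/-- Supplies compactness: positive semidefinite matrices of bounded trace form a bounded set. -/
theorem abs_apply_le_of_posSemidef {n : Type*} [Fintype n] [DecidableEq n] {A : Matrix n n ℝ}
    (h : A.PosSemidef) (i j : n) : |A i j| ≤ A.trace := by
  have hs : A j i = A i j := by simpa using h.1.apply i j
  have hd : A i i + A j j ≤ 2 * A.trace := by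
    have : ∀ k, A k k ≤ A.trace := fun k =>
      Finset.single_le_sum (f := fun k => A k k) (fun k _ => h.diag_nonneg) (Finset.mem_univ k)
    linarith [this i, this j]
  have hp := h.dotProduct_mulVec_nonneg (Pi.single i 1 + Pi.single j 1)
  have hm := h.dotProduct_mulVec_nonneg (Pi.single i 1 - Pi.single j 1)
  simp only [star_trivial, mulVec_add, mulVec_sub, add_dotProduct, sub_dotProduct,
    dotProduct_add, dotProduct_sub, single_one_dotProduct, mulVec_single_one, col_apply, hs]
    at hp hm
  rw [abs_le]
  constructor <;> linarith

end Modes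

/-! ### Blocks of Choi–Jamiołkowski matrices, local sums and conjugation by `Λ`. -/

theorem mul_sympJ_mul_apply {M K L : Type*} [Fintype M] [DecidableEq M]
    (X : Matrix K (M × Fin 2) ℝ) (Y : Matrix (M × Fin 2) L ℝ) (k : K) (l : L) :
    (X * sympJ M * Y) k l = ∑ m, (X k (m, 1) * Y (m, 0) l - X k (m, 0) * Y (m, 1) l) := by
  simp only [Matrix.mul_apply, Fintype.sum_prod_type, Fin.sum_univ_two, sympJ, kroneckerMap_apply,
    Matrix.one_apply]
  refine Finset.sum_congr rfl fun m _ => ?_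
  rw [Finset.sum_eq_single m (fun b _ hb => by simp [hb]) (by simp),
    Finset.sum_eq_single m (fun b _ hb => by simp [hb]) (by simp)]
  simp
  ring

theorem sympJ_apply {M : Type*} [DecidableEq M] (a b : M) (p q : Fin 2) :
    sympJ M (a, p) (b, q) =
      if a = b then (!![0, -1; 1, 0] : Matrix (Fin 2) (Fin 2) ℝ) p q else 0 := by
  simp [sympJ, Matrix.one_apply]

/-- The output modes, then the input modes, as modes of the operation. -/
def portIndex : (Fin 3 × Fin 2) ⊕ (Fin 3 × Fin 2) → (Fin 3 × Fin 2) × Fin 2 :=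
  Sum.elim (fun k => ((k.1, 0), k.2)) (fun k => ((k.1, 1), k.2))

theorem submatrix_portIndex (Γ : CJ3) :
    Γ.submatrix portIndex portIndex = fromBlocks (portBlock Γ 0 0) (portBlock Γ 0 1)
      (portBlock Γ 1 0) (portBlock Γ 1 1) := by
  ext (k | k) (l | l) <;> rfl

theorem portBlock_mul_sympJ_mul (Γ Δ : CJ3) (a b : Fin 2) :
    portBlock (Γ * sympJ (Fin 3 × Fin 2) * Δ) a b =
      portBlock Γ a 0 * sympJ (Fin 3) * portBlock Δ 0 b +
      portBlock Γ a 1 * sympJ (Fin 3) * portBlock Δ 1 b := by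
  ext k l
  rw [Matrix.add_apply, mul_sympJ_mul_apply, mul_sympJ_mul_apply, portBlock, submatrix_apply,
    mul_sympJ_mul_apply, Fintype.sum_prod_type, ← Finset.sum_add_distrib]
  refine Finset.sum_congr rfl fun x _ => ?_
  rw [Fin.sum_univ_two]
  rfl

theorem portBlock_sympJ (a b : Fin 2) :
    portBlock (sympJ (Fin 3 × Fin 2)) a b = if a = b then sympJ (Fin 3) else 0 := by
  ext ⟨x, q⟩ ⟨y, r⟩
  by_cases hab : a = b <;> by_cases hxy : x = y <;>
    simp [portBlock, sympJ_apply, hab, hxy]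

theorem portBlock_conjTranspose {Γ : CJ3} (h : Γ.IsHermitian) (a b : Fin 2) :
    (portBlock Γ a b)ᴴ = portBlock Γ b a := by
  ext k l
  exact h.apply _ _

theorem localSum_apply (G : Fin 3 → LocalCJ) (x y : Fin 3) (a b q r : Fin 2) :
    localSum G ((x, a), q) ((y, b), r) = if x = y then G x (a, q) (b, r) else 0 := rfl

theorem localSum_mul_sympJ_mul {G : Fin 3 → LocalCJ} (h : ∀ x, IsPureCM (G x)) :
    localSum G * sympJ (Fin 3 × Fin 2) * localSum G = sympJ (Fin 3 × Fin 2) := by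
  ext ⟨⟨x, a⟩, q⟩ ⟨⟨y, b⟩, r⟩
  rw [mul_sympJ_mul_apply, Fintype.sum_prod_type,
    Finset.sum_eq_single x (fun m _ hm => by simp [localSum_apply, Ne.symm hm]) (by simp)]
  by_cases hxy : x = y
  · subst hxy
    have := congrFun₂ (h x).mul_sympJ_mul (a, q) (b, r)
    rw [mul_sympJ_mul_apply] at this
    simp only [localSum_apply, if_true, this, sympJ_apply, Prod.mk.injEq, true_and]
  · simp [localSum_apply, sympJ_apply, hxy]

theorem posSemidef_localSum {G : Fin 3 → LocalCJ} (h : ∀ x, (G x).PosSemidef) :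
    (localSum G).PosSemidef := by
  refine PosSemidef.of_dotProduct_mulVec_nonneg ?_ fun v => ?_
  · ext ⟨⟨x, a⟩, q⟩ ⟨⟨y, b⟩, r⟩
    by_cases hxy : x = y
    · subst hxy
      simpa [localSum_apply] using (h x).1.apply (a, q) (b, r)
    · simp [localSum_apply, hxy, Ne.symm hxy]
  · have : star v ⬝ᵥ localSum G *ᵥ v =
        ∑ x, star (fun k : Fin 2 × Fin 2 => v ((x, k.1), k.2)) ⬝ᵥ
          G x *ᵥ (fun k : Fin 2 × Fin 2 => v ((x, k.1), k.2)) := by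
      simp only [dotProduct, mulVec, Fintype.sum_prod_type, localSum_apply, star_trivial]
      refine Finset.sum_congr rfl fun x _ => Finset.sum_congr rfl fun a _ =>
        Finset.sum_congr rfl fun q _ => ?_
      rw [Finset.sum_eq_single x (fun m _ hm => by simp [Ne.symm hm]) (by simp)]
      simp
    rw [this]
    exact Finset.sum_nonneg fun x _ => (h x).dotProduct_mulVec_nonneg _

theorem isPureCM_localSum {G : Fin 3 → LocalCJ} (h : ∀ x, IsPureCM (G x)) :
    IsPureCM (localSum G) :=
  isPureCM_iff.2 ⟨posSemidef_localSum fun x => (h x).1.posSemidef, localSum_mul_sympJ_mul h⟩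

theorem Lam_mul_mul_Lam_apply (γ : CM3) (i j : Fin 3) (q r : Fin 2) :
    (Lam * γ * Lam) (i, q) (j, r) = (![1, -1] q * γ (i, q) (j, r)) * ![1, -1] r := by
  have h : Lam = diagonal fun k : Fin 3 × Fin 2 => (![1, -1] k.2 : ℝ) := by
    ext ⟨a, p⟩ ⟨b, q⟩
    by_cases hab : a = b <;> fin_cases p <;> fin_cases q <;>
      simp [Lam, sigmaZ, hab]
  rw [h, mul_diagonal, diagonal_mul]

/-- `Λ` is antisymplectic, `ΛJΛ = -J`, so both sides of `γJγ = J` change sign. -/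
theorem IsPureCM.Lam_mul_mul_Lam {γ : CM3} (h : IsPureCM γ) : IsPureCM (Lam * γ * Lam) := by
  rw [isPureCM_iff]
  constructor
  · have hL : Lamᴴ = Lam := by
      ext ⟨a, p⟩ ⟨b, q⟩
      by_cases hab : a = b
      · subst hab
        fin_cases p <;> fin_cases q <;> simp [Lam, sigmaZ]
      · simp [Lam, hab, Ne.symm hab]
    have := h.1.posSemidef.mul_mul_conjTranspose_same Lam
    rwa [hL] at this
  · ext ⟨i, q⟩ ⟨j, r⟩
    have := congrFun₂ h.mul_sympJ_mul (i, q) (j, r)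
    rw [mul_sympJ_mul_apply] at this ⊢
    simp only [Lam_mul_mul_Lam_apply]
    have e : ∀ m, (![1, -1] q * γ (i, q) (m, 1)) * ![1, -1] 1 *
        ((![1, -1] 0 * γ (m, 0) (j, r)) * ![1, -1] r) -
        (![1, -1] q * γ (i, q) (m, 0)) * ![1, -1] 0 *
        ((![1, -1] 1 * γ (m, 1) (j, r)) * ![1, -1] r) =
        (-(![1, -1] q * ![1, -1] r)) * (γ (i, q) (m, 1) * γ (m, 0) (j, r) -
          γ (i, q) (m, 0) * γ (m, 1) (j, r)) := by
      intro m
      simp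
      ring
    rw [Finset.sum_congr rfl fun m _ => e m, ← Finset.mul_sum, this, sympJ_apply]
    by_cases hij : i = j <;> fin_cases q <;> fin_cases r <;> simp [hij]

/-! ### Outputs: positivity, monotonicity, purity, and the reduction from mixed to pure operations.
-/

theorem posSemidef_fromBlocks_zero {m n : Type*} [Fintype m] [Fintype n] {E : Matrix n n ℝ}
    (h : E.PosSemidef) : (fromBlocks (0 : Matrix m m ℝ) 0 0 E).PosSemidef := by
  refine PosSemidef.of_dotProduct_mulVec_nonneg ?_ fun x => ?_
  · exact Matrix.IsHermitian.fromBlocks isHermitian_zero (by simp) h.1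
  · have := h.dotProduct_mulVec_nonneg (x ∘ Sum.inr)
    simpa [dotProduct, mulVec, fromBlocks, Fintype.sum_sum_type] using this

theorem posDef_portBlock_add {Γ : CJ3} (h : Γ.PosSemidef) {g : CM3} (hg : g.PosDef) :
    (portBlock Γ 1 1 + g).PosDef :=
  hg.posSemidef_add (h.submatrix _)

theorem posSemidef_output {Γ : CJ3} (h : Γ.PosSemidef) {γ : CM3} (hγ : IsPureCM γ) :
    (output Γ γ).PosSemidef := by
  have hD := posDef_portBlock_add h hγ.Lam_mul_mul_Lam.1
  have := hD.isUnit.invertible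
  have h1 := (h.submatrix portIndex).add
    (posSemidef_fromBlocks_zero (m := Fin 3 × Fin 2) hγ.Lam_mul_mul_Lam.1.posSemidef)
  rw [submatrix_portIndex, fromBlocks_add, ← portBlock_conjTranspose h.1 0 1] at h1
  simp only [add_zero] at h1
  rw [PosDef.fromBlocks₂₂ _ _ hD] at h1
  simpa [output] using h1

/-- The output is a Schur complement, i.e. the largest `p` that can be subtracted from the output
block while the whole matrix, with `ΛγΛ` added to the input block, stays positive semidefinite.
Enlarging the matrix can only enlarge it. -/
theorem posSemidef_output_sub {Γ Δ : CJ3} (hΔ : Δ.PosSemidef) (h : (Γ - Δ).PosSemidef) {γ : CM3}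
    (hγ : IsPureCM γ) : (output Γ γ - output Δ γ).PosSemidef := by
  have hΓ : Γ.PosSemidef := by simpa using h.add hΔ
  have hD := posDef_portBlock_add hΓ hγ.Lam_mul_mul_Lam.1
  have hD' := posDef_portBlock_add hΔ hγ.Lam_mul_mul_Lam.1
  have := hD.isUnit.invertible
  have := hD'.isUnit.invertible
  have h1 : (fromBlocks (portBlock Δ 0 0 - output Δ γ) (portBlock Δ 0 1) (portBlock Δ 0 1)ᴴ
      (portBlock Δ 1 1 + Lam * γ * Lam)).PosSemidef := by
    rw [PosDef.fromBlocks₂₂ _ _ hD']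
    simp [output, PosSemidef.zero]
  have h2 := h1.add (h.submatrix portIndex)
  have e : ∀ a b, portBlock (Γ - Δ) a b = portBlock Γ a b - portBlock Δ a b := fun a b => rfl
  rw [submatrix_portIndex, portBlock_conjTranspose hΔ.1, fromBlocks_add, e, e, e, e] at h2
  have e0 : portBlock Δ 0 0 - output Δ γ + (portBlock Γ 0 0 - portBlock Δ 0 0) =
    portBlock Γ 0 0 - output Δ γ := by abel
  have e1 : portBlock Δ 1 1 + Lam * γ * Lam + (portBlock Γ 1 1 - portBlock Δ 1 1) =
    portBlock Γ 1 1 + Lam * γ * Lam := by abel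
  rw [e0, e1, add_sub_cancel, add_sub_cancel, ← portBlock_conjTranspose hΓ.1 0 1,
    PosDef.fromBlocks₂₂ _ _ hD] at h2
  have e2 : ∀ p, output Γ γ - p = portBlock Γ 0 0 - p - portBlock Γ 0 1 *
      (portBlock Γ 1 1 + Lam * γ * Lam)⁻¹ * (portBlock Γ 0 1)ᴴ := fun p => by
    rw [output, conjTranspose_eq_transpose_of_trivial, sub_right_comm]
  rwa [e2]

/-- Projecting a pure state on a part of a pure state leaves a pure state. -/
theorem schur_mul_mul_schur {R : Type*} [Ring R] {A B C C' D W J g : R}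
    (h00 : A * J * A + C * J * C' = J) (h01 : A * J * C + C * J * B = 0)
    (h10 : C' * J * A + B * J * C' = 0) (h11 : C' * J * C + B * J * B = J)
    (hg : g * J * g = J) (hD : D = B + g) (hDW : D * W = 1) (hWD : W * D = 1) :
    (A - C * W * C') * J * (A - C * W * C') = J := by
  have hmid : -(D * J * D) + D * J * B + B * J * D + J - B * J * B = 0 := by
    rw [hD]
    calc _ = J - g * J * g := by noncomm_ring
      _ = 0 := by rw [hg, sub_self]
  have hDW' : ∀ x, D * (W * x) = x := fun x => by rw [← mul_assoc, hDW, one_mul]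
  have hWD' : ∀ x, W * (D * x) = x := fun x => by rw [← mul_assoc, hWD, one_mul]
  have hin : -J + J * B * W + W * B * J + W * (J - B * J * B) * W = 0 := by
    calc _ = W * (-(D * J * D) + D * J * B + B * J * D + J - B * J * B) * W := by
          simp only [mul_add, add_mul, mul_sub, sub_mul, mul_neg, neg_mul, mul_assoc, hWD', hDW,
            mul_one]
          abel
      _ = 0 := by rw [hmid]; simp
  have e00 : A * J * A = J - C * J * C' := eq_sub_of_add_eq h00
  have e01 : A * J * C = -(C * J * B) := eq_neg_of_add_eq_zero_left h01
  have e10 : C' * J * A = -(B * J * C') := eq_neg_of_add_eq_zero_left h10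
  have e11 : C' * J * C = J - B * J * B := eq_sub_of_add_eq h11
  calc (A - C * W * C') * J * (A - C * W * C')
      = A * J * A - (A * J * C) * W * C' - C * W * (C' * J * A) +
          C * W * (C' * J * C) * W * C' := by noncomm_ring
    _ = J + C * (-J + J * B * W + W * B * J + W * (J - B * J * B) * W) * C' := by
        rw [e00, e01, e10, e11]; noncomm_ring
    _ = J := by rw [hin]; simp

theorem isPureCM_output {Γ : CJ3} (h : IsPureCM Γ) {γ : CM3} (hγ : IsPureCM γ) :
    IsPureCM (output Γ γ) := by
  refine isPureCM_iff.2 ⟨posSemidef_output h.1.posSemidef hγ, ?_⟩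
  have hJ : ∀ a b, portBlock Γ a 0 * sympJ (Fin 3) * portBlock Γ 0 b +
      portBlock Γ a 1 * sympJ (Fin 3) * portBlock Γ 1 b = if a = b then sympJ (Fin 3) else 0 := by
    intro a b
    rw [← portBlock_mul_sympJ_mul, h.mul_sympJ_mul, portBlock_sympJ]
  have hT : (portBlock Γ 0 1)ᵀ = portBlock Γ 1 0 := by
    simpa using portBlock_conjTranspose h.1.1 0 1
  have hD := (Matrix.isUnit_iff_isUnit_det _).1
    (posDef_portBlock_add h.1.posSemidef hγ.Lam_mul_mul_Lam.1).isUnit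
  rw [output, hT]
  exact schur_mul_mul_schur (by simpa using hJ 0 0) (by simpa using hJ 0 1)
    (by simpa using hJ 1 0) (by simpa using hJ 1 1) hγ.Lam_mul_mul_Lam.mul_sympJ_mul rfl
    (Matrix.mul_nonsing_inv _ hD) (Matrix.nonsing_inv_mul _ hD)

open scoped Pointwise in
/-- Mixed operations give no pure outputs beyond those of the pure ones. -/
theorem Reaches.pureReaches {γ γ' : CM3} (hγ : IsPureCM γ) (hγ' : IsPureCM γ')
    (h : Reaches γ γ') : PureReaches γ γ' := by
  set R := {δ | ∃ Γ, IsPureGLOCC Γ ∧ δ = output Γ γ} with hR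
  have hRp : closure R ⊆ {p | IsPureCM p} := by
    refine closure_minimal ?_ isClosed_isPureCM
    rintro _ ⟨Γ, ⟨G, hG, rfl⟩, rfl⟩
    exact isPureCM_output (isPureCM_localSum hG) hγ
  set U : Set CM3 := {δ | δ.trace < γ'.trace + 1} with hU
  have hUo : IsOpen U := isOpen_lt (by fun_prop) continuous_const
  -- Near `γ'` the trace is bounded, hence so are the pure outputs below. Cutting `closure R` down
  -- to a compact box makes its sum with the closed positive cone closed.
  set K : Set CM3 := closure R ∩
    (Set.univ.pi fun _ => Set.univ.pi fun _ => Set.Icc (-(γ'.trace + 1)) (γ'.trace + 1)) with hK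
  have hKc : IsCompact K :=
    (isCompact_univ_pi fun _ => isCompact_univ_pi fun _ => isCompact_Icc).inter_left isClosed_closure
  have hcl : IsClosed (K + {A : CM3 | A.PosSemidef}) :=
    isClosed_posSemidef.add_left_of_isCompact hKc
  have hsub : U ∩ {δ | ∃ Γ, IsGLOCC Γ ∧ δ = output Γ γ} ⊆ K + {A : CM3 | A.PosSemidef} := by
    rintro _ ⟨hδ, Γ, ⟨G, hG, hΓ⟩, rfl⟩
    have hL := isPureCM_localSum hG
    have hd := posSemidef_output_sub hL.1.posSemidef hΓ hγ
    have hp := isPureCM_output hL hγ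
    refine ⟨output (localSum G) γ, ⟨subset_closure ⟨_, ⟨G, hG, rfl⟩, rfl⟩, ?_⟩, _, hd, by simp⟩
    have ht := hd.trace_nonneg
    rw [trace_sub] at ht
    simp only [hU, Set.mem_ofPred_eq] at hδ
    intro i _ j _
    have := abs_le.1 (abs_apply_le_of_posSemidef hp.1.posSemidef i j)
    constructor <;> linarith
  have hmem : γ' ∈ K + {A : CM3 | A.PosSemidef} :=
    closure_minimal hsub hcl (hUo.inter_closure ⟨by simp [hU], h⟩)
  obtain ⟨p, hp, E, hE, rfl⟩ := hmem
  -- Minimality of the pure state `p + E` forces `E = 0`.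
  have := (hRp hp.1).eq_of_posSemidef_sub hγ' (by simpa using hE)
  simp only [this]
  exact hp.1

/-! ### Relabelling of modes and determinant identities. -/

section Permutation

variable {M : Type*} [Fintype M] [DecidableEq M]

/-- The action of a permutation of the modes on phase-space indices. -/
def modePerm (e : Equiv.Perm M) : Equiv.Perm (M × Fin 2) := e.prodCongr (Equiv.refl _)

theorem IsPureCM.submatrix_modePerm {γ : Matrix (M × Fin 2) (M × Fin 2) ℝ} (h : IsPureCM γ)
    (e : Equiv.Perm M) : IsPureCM (γ.submatrix (modePerm e) (modePerm e)) := by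
  have hJ : (sympJ M).submatrix (modePerm e) (modePerm e) = sympJ M := by
    ext ⟨a, p⟩ ⟨b, q⟩
    simp [sympJ_apply, modePerm]
  refine isPureCM_iff.2 ⟨h.1.posSemidef.submatrix _, ?_⟩
  nth_rw 1 [← hJ]
  rw [submatrix_mul_equiv, submatrix_mul_equiv, h.mul_sympJ_mul, hJ]

end Permutation

theorem exists_perm_of_ne {i j : Fin 3} (h : i ≠ j) :
    ∃ e : Equiv.Perm (Fin 3), e 0 = i ∧ e 1 = j := by
  revert i j
  decide

/-- The indices of the modes `0`, `1`, `2`, in this order. -/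
def modeSum : Fin 2 ⊕ (Fin 2 ⊕ Fin 2) → Fin 3 × Fin 2 :=
  Sum.elim (fun q => (0, q)) (Sum.elim (fun q => (1, q)) (fun q => (2, q)))

theorem modeSum_bijective : Function.Bijective modeSum := by
  constructor
  · unfold Function.Injective; decide
  · unfold Function.Surjective; decide

/-- The submatrix of a three-mode matrix without the rows of mode `1` and the columns of mode
`0`. -/
def minorBlock (A : CM3) : Matrix (Fin 2 ⊕ Fin 2) (Fin 2 ⊕ Fin 2) ℝ :=
  fromBlocks (modeBlock A 0 1) (modeBlock A 0 2) (modeBlock A 2 1) (modeBlock A 2 2)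

/-- Jacobi's identity for complementary minors. -/
theorem det_modeBlock_inv_mul_det {A : CM3} (hA : IsUnit A.det) :
    (modeBlock A⁻¹ 0 1).det * A.det = (minorBlock A).det := by
  set c : Fin 2 ⊕ (Fin 2 ⊕ Fin 2) ≃ Fin 3 × Fin 2 := Equiv.ofBijective _ modeSum_bijective with hc
  set σ : Equiv.Perm (Fin 3 × Fin 2) := modePerm (Equiv.swap 0 1) with hσ
  -- Exchanging two modes exchanges two pairs of indices, an even permutation, so Jacobi's identity
  -- carries no sign.
  have hsign : Equiv.Perm.sign σ = 1 := by rw [hσ]; decide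
  have hdet : (A.submatrix (σ ∘ c) c).det = A.det := by
    rw [show A.submatrix (σ ∘ c) c = (A.submatrix σ id).submatrix c c from rfl, det_submatrix_equiv_self, det_permute, hsign]
    simp
  -- The first block column of the right factor is the column of mode `1` of `A⁻¹`; with the rows of
  -- modes `0` and `1` of `A` exchanged, `A * A⁻¹ = 1` makes the product block triangular.
  have h1 : A.submatrix (σ ∘ c) c * fromBlocks (modeBlock A⁻¹ 0 1) 0
      (Matrix.of fun p s => Sum.elim (fun p => A⁻¹ (1, p) (1, s)) (fun p => A⁻¹ (2, p) (1, s)) p) 1 =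
      fromBlocks 1 (Matrix.of fun p => Sum.elim (modeBlock A 1 1 p) (modeBlock A 1 2 p))
        0 (minorBlock A) := by
    have hmul := Matrix.mul_nonsing_inv A hA
    have hent : ∀ (x : Fin 3) (p q : Fin 2), A (x, p) (0, 0) * A⁻¹ (0, 0) (1, q) +
        A (x, p) (0, 1) * A⁻¹ (0, 1) (1, q) + (A (x, p) (1, 0) * A⁻¹ (1, 0) (1, q) +
        A (x, p) (1, 1) * A⁻¹ (1, 1) (1, q)) + (A (x, p) (2, 0) * A⁻¹ (2, 0) (1, q) +
        A (x, p) (2, 1) * A⁻¹ (2, 1) (1, q)) = if x = 1 ∧ p = q then 1 else 0 := by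
      intro x p q
      have := congrFun₂ hmul (x, p) (1, q)
      simpa only [Matrix.mul_apply, Fintype.sum_prod_type, Fin.sum_univ_three, Fin.sum_univ_two,
        Matrix.one_apply, Prod.mk.injEq] using this
    ext r s
    rw [Matrix.mul_apply, Fintype.sum_sum_type, Fintype.sum_sum_type]
    rcases s with s | s
    · rcases r with r | r | r
      · have := hent 1 r s
        simp [c, σ, modePerm, modeSum, modeBlock, Fin.sum_univ_two, Matrix.one_apply] at this ⊢
        linarith
      · have := hent 0 r s
        simp [c, σ, modePerm, modeSum, modeBlock, Fin.sum_univ_two] at this ⊢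
        linarith
      · have := hent 2 r s
        have h2 : (Equiv.swap (0 : Fin 3) 1) 2 = 2 := by decide
        simp [c, σ, modePerm, modeSum, modeBlock, Fin.sum_univ_two, h2]
          at this ⊢
        linarith
    · have h2 : (Equiv.swap (0 : Fin 3) 1) 2 = 2 := by decide
      rcases r with r | r | r <;> rcases s with s | s <;>
        simp [c, σ, modePerm, modeSum, modeBlock, minorBlock, Matrix.one_apply, h2]
  have h2 := congrArg Matrix.det h1
  rw [det_mul, hdet, det_fromBlocks_zero₁₂, det_fromBlocks_zero₂₁, det_one, det_one, mul_one,
    one_mul] at h2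
  rw [← h2, mul_comm]

/-- For invertible `X` this is `det X * det (K - Z X⁻¹ Y + B)` expanded in `B`; adjugates free it of
invertibility. -/
theorem det_fromBlocks_add (X Y Z K B : Matrix (Fin 2) (Fin 2) ℝ) :
    (fromBlocks X Y Z (K + B)).det =
      X.det * B.det + (adjugate B * (X.det • K - Z * adjugate X * Y)).trace +
        (fromBlocks X Y Z K).det := by
  have h : ∀ E : Matrix (Fin 2 ⊕ Fin 2) (Fin 2 ⊕ Fin 2) ℝ,
      E.det = (E.submatrix finSumFinEquiv.symm finSumFinEquiv.symm).det := fun E =>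
    (det_submatrix_equiv_self _ _).symm
  have f0 : (finSumFinEquiv (m := 2) (n := 2)).symm (0 : Fin 4) = Sum.inl 0 := by decide
  have f1 : (finSumFinEquiv (m := 2) (n := 2)).symm (1 : Fin 4) = Sum.inl 1 := by decide
  have f2 : (finSumFinEquiv (m := 2) (n := 2)).symm (2 : Fin 4) = Sum.inr 0 := by decide
  have f3 : (finSumFinEquiv (m := 2) (n := 2)).symm (3 : Fin 4) = Sum.inr 1 := by decide
  have hd : ∀ E : Matrix (Fin 4) (Fin 4) ℝ, E.det =
      E 0 0 * (E 1 1 * (E 2 2 * E 3 3 - E 2 3 * E 3 2) - E 1 2 * (E 2 1 * E 3 3 - E 2 3 * E 3 1) +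
        E 1 3 * (E 2 1 * E 3 2 - E 2 2 * E 3 1)) -
      E 0 1 * (E 1 0 * (E 2 2 * E 3 3 - E 2 3 * E 3 2) - E 1 2 * (E 2 0 * E 3 3 - E 2 3 * E 3 0) +
        E 1 3 * (E 2 0 * E 3 2 - E 2 2 * E 3 0)) +
      E 0 2 * (E 1 0 * (E 2 1 * E 3 3 - E 2 3 * E 3 1) - E 1 1 * (E 2 0 * E 3 3 - E 2 3 * E 3 0) +
        E 1 3 * (E 2 0 * E 3 1 - E 2 1 * E 3 0)) -
      E 0 3 * (E 1 0 * (E 2 1 * E 3 2 - E 2 2 * E 3 1) - E 1 1 * (E 2 0 * E 3 2 - E 2 2 * E 3 0) +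
        E 1 2 * (E 2 0 * E 3 1 - E 2 1 * E 3 0)) := by
    intro E
    rw [det_succ_row_zero]
    have e : (2 : Fin 3).succ = (3 : Fin 4) := rfl
    have e' : (1 : Fin 3).succ = (2 : Fin 4) := rfl
    have e2 : (2 : Fin 3).castSucc = (2 : Fin 4) := rfl
    have e1 : (1 : Fin 3).castSucc = (1 : Fin 4) := rfl
    simp [Fin.sum_univ_four, det_fin_three, Fin.succAbove, e, e', e1, e2]
    ring
  rw [h, h (fromBlocks X Y Z K), hd, hd]
  simp only [submatrix_apply, f0, f1, f2, f3, fromBlocks_apply₁₁, fromBlocks_apply₁₂,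
    fromBlocks_apply₂₁, fromBlocks_apply₂₂, Matrix.add_apply, det_fin_two, adjugate_fin_two,
    trace_fin_two, Matrix.mul_apply, Fin.sum_univ_two, Matrix.sub_apply, Matrix.smul_apply,
    smul_eq_mul, of_apply, cons_val_zero, cons_val_one]
  ring

/-! ### The sign of the complementary minor. -/

theorem trace_adjugate_mul_nonpos {B Q : Matrix (Fin 2) (Fin 2) ℝ} (hB : B.PosDef)
    (hQ : ∀ t, t ⬝ᵥ Q *ᵥ t ≤ 0) : (adjugate B * Q).trace ≤ 0 := by
  have hp := hB.diag_pos (i := 0)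
  have hd := hB.det_pos
  have hs : B 1 0 = B 0 1 := by simpa using hB.1.apply 0 1
  -- With `w` this vector, `B 0 0 * tr (adj B * Q) = w · Qw + det B * Q 0 0`.
  have h1 := hQ ![-B 0 1, B 0 0]
  have h2 := hQ ![1, 0]
  simp only [dotProduct, mulVec, Fin.sum_univ_two, cons_val_zero, cons_val_one] at h1 h2
  rw [det_fin_two, hs] at hd
  have e : B 0 0 * (adjugate B * Q).trace ≤ 0 := by
    simp only [adjugate_fin_two, trace_fin_two, Matrix.mul_apply, Fin.sum_univ_two, of_apply,
      cons_val_zero, cons_val_one, hs]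
    nlinarith
  by_contra! h
  linarith [mul_pos hp h]

theorem IsPureCM.apply_comm {M : Type*} [Fintype M] [DecidableEq M]
    {γ : Matrix (M × Fin 2) (M × Fin 2) ℝ} (h : IsPureCM γ) (k l : M × Fin 2) : γ k l = γ l k :=
  congrFun₂ h.transpose_eq l k

/-- The determinants of the blocks of a row sum to one. -/
theorem IsPureCM.sum_det_modeBlock {M : Type*} [Fintype M] [DecidableEq M]
    {γ : Matrix (M × Fin 2) (M × Fin 2) ℝ} (h : IsPureCM γ) (i : M) :
    ∑ j, (modeBlock γ i j).det = 1 := by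
  have h1 := congrFun₂ h.mul_sympJ_mul (i, 1) (i, 0)
  rw [mul_sympJ_mul_apply, sympJ_apply] at h1
  simp only [if_true, of_apply, cons_val_zero, cons_val_one] at h1
  rw [← h1]
  refine Finset.sum_congr rfl fun j _ => ?_
  rw [det_fin_two, h.apply_comm (j, 0), h.apply_comm (j, 1)]
  simp only [modeBlock, submatrix_apply]
  ring

theorem IsPureCM.one_le_det_modeBlock {M : Type*} [Fintype M] [DecidableEq M]
    {γ : Matrix (M × Fin 2) (M × Fin 2) ℝ} (h : IsPureCM γ) (i : M) :
    1 ≤ (modeBlock γ i i).det := by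
  have hp : 0 < γ (i, 0) (i, 0) := h.1.diag_pos
  -- These vectors turn the uncertainty relation into `γ₀₀ (det - 1) ≥ 0`, where `γ₀₀` and `det`
  -- belong to the block of mode `i`.
  have h1 := h.uncertainty
    (Pi.single (i, 0) (-γ (i, 0) (i, 1)) + Pi.single (i, 1) (γ (i, 0) (i, 0)))
    (Pi.single (i, 0) (-1))
  have e : ∀ k, (Pi.single k (-1) : M × Fin 2 → ℝ) = -Pi.single k 1 := fun k => by
    rw [Pi.single_neg]
  have e' : ∀ k (c : ℝ), (Pi.single k c : M × Fin 2 → ℝ) = c • Pi.single k 1 := fun k c => by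
    rw [← Pi.single_smul, smul_eq_mul, mul_one]
  rw [e, e' _ (-_), e' (i, 1)] at h1
  simp only [mulVec_add, mulVec_neg, mulVec_smul, add_dotProduct, dotProduct_add, neg_dotProduct,
    dotProduct_neg, smul_dotProduct, dotProduct_smul, single_one_dotProduct, mulVec_single_one,
    col_apply, sympJ_apply, smul_eq_mul, if_true, of_apply, cons_val_zero, cons_val_one,
    h.apply_comm (i, 1) (i, 0)] at h1
  simp only [det_fin_two, modeBlock, submatrix_apply, h.apply_comm (i, 1) (i, 0)]
  by_contra! hlt
  nlinarith

theorem quadratic_bound {T q c : ℝ} (hT : 0 ≤ T) (hc : 0 ≤ c)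
    (h : ∀ k : ℝ, 0 ≤ T - 2 * k * q + k ^ 2 * (c * q)) : q ≤ c * T := by
  by_contra! hlt
  have hq : 0 < q := lt_of_le_of_lt (by positivity) hlt
  have hd : discrim (c * q) (-2 * q) T ≤ 0 :=
    discrim_le_zero fun k => by linarith [h k]
  rw [discrim] at hd
  nlinarith

/-- The quadratic form that gives the part of `det (minorBlock M)` linear in a noise added to
mode `2` is negative semidefinite. -/
theorem IsPureCM.coefficient_nonpos {γ : CM3} (h : IsPureCM γ)
    (t : Fin 2 → ℝ) :
    t ⬝ᵥ ((modeBlock γ 0 1).det • modeBlock γ 2 2 -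
      modeBlock γ 2 1 * adjugate (modeBlock γ 0 1) * modeBlock γ 0 2) *ᵥ t ≤ 0 := by
  set T := t ⬝ᵥ modeBlock γ 2 2 *ᵥ t with hT
  set H := modeBlock γ 1 2 *ᵥ t with hH
  set q := H ⬝ᵥ adjugate (modeBlock γ 1 1) *ᵥ H with hq
  have hs := h.apply_comm
  have hb := h.sum_det_modeBlock 1
  have hb1 := h.one_le_det_modeBlock 1
  have h10 : (modeBlock γ 1 0).det = (modeBlock γ 0 1).det := by
    simp only [modeBlock, det_fin_two, submatrix_apply, hs (1, _) (0, _)]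
    ring
  rw [Fin.sum_univ_three, h10] at hb
  have hquad : ∀ k : ℝ, 0 ≤ T - 2 * k * q + k ^ 2 * (((modeBlock γ 1 1).det - 1) * q) := by
    intro k
    -- On mode `1`, `u` is the direction minimising the `γ`-form for given `t`, scaled by `k`, and
    -- `v` is chosen with `Jv = kH`. The three terms in `k²` have coefficients `det γ₁₁ * q`, `q`
    -- and `-2q`, which leaves `(det γ₁₁ - 1) q`.
    have h0 := h.uncertainty
      (fun x => ![![0, 0], -k • adjugate (modeBlock γ 1 1) *ᵥ H, t] x.1 x.2)
      (fun x => ![![0, 0], ![k * H 1, -k * H 0], ![0, 0]] x.1 x.2)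
    refine h0.trans_eq ?_
    rw [hT, hq]
    simp only [dotProduct, mulVec, Fintype.sum_prod_type, Fin.sum_univ_three, Fin.sum_univ_two,
      cons_val_zero, cons_val_one, cons_val_two, sympJ_apply, of_apply, adjugate_fin_two,
      det_fin_two, modeBlock, submatrix_apply, Pi.smul_apply, smul_eq_mul, hH,
      hs (2, _) (1, _), hs (1, 1) (1, 0)]
    simp
    ring
  have hT0 : 0 ≤ T :=
    (h.1.posSemidef.submatrix (fun q => ((2 : Fin 3), q))).dotProduct_mulVec_nonneg t
  have hbound := quadratic_bound hT0 (by linarith) hquad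
  have hrel : ∀ p r, _ := fun p r => congrFun₂ h.mul_sympJ_mul ((1 : Fin 3), p) ((2 : Fin 3), r)
  have key : t ⬝ᵥ ((modeBlock γ 0 1).det • modeBlock γ 2 2 -
      modeBlock γ 2 1 * adjugate (modeBlock γ 0 1) * modeBlock γ 0 2) *ᵥ t =
      ((modeBlock γ 0 1).det + (modeBlock γ 1 2).det) * T + q := by
    have r00 := hrel 0 0
    have r01 := hrel 0 1
    have r10 := hrel 1 0
    have r11 := hrel 1 1
    simp only [mul_sympJ_mul_apply, sympJ_apply, Fin.sum_univ_three] at r00 r01 r10 r11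
    simp only [hT, hq, hH, dotProduct, mulVec, Fin.sum_univ_two, Matrix.sub_apply,
      Matrix.smul_apply, Matrix.mul_apply, smul_eq_mul, adjugate_fin_two, det_fin_two, of_apply,
      cons_val_zero, cons_val_one, modeBlock, submatrix_apply]
    simp [hs (2, _) (1, _), hs (1, 1) (1, 0), hs (1, _) (0, _), hs (2, 1) (2, 0)] at r00 r01 r10 r11 ⊢
    -- The block `(1, 2)` of `γJγ = J` vanishes; it is contracted with `t` on the right and `(H 1,
    -- -H 0)` on the left.
    linear_combination
      (γ (1, 1) (2, 0) * t 0 + γ (1, 1) (2, 1) * t 1) * (t 0 * r00 + t 1 * r01) -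
      (γ (1, 0) (2, 0) * t 0 + γ (1, 0) (2, 1) * t 1) * (t 0 * r10 + t 1 * r11)
  -- As the determinants of row `1` sum to one, the expression is `q - (det γ₁₁ - 1) T`, which
  -- `hbound` controls.
  rw [key]
  nlinarith

theorem minorBlock_det_nonpos {γ M : CM3} (h : IsPureCM γ) (hn : NonposDets γ)
    {B : Matrix (Fin 2) (Fin 2) ℝ} (hB : B.PosDef) (h01 : modeBlock M 0 1 = modeBlock γ 0 1)
    (h02 : modeBlock M 0 2 = modeBlock γ 0 2) (h21 : modeBlock M 2 1 = modeBlock γ 2 1)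
    (h22 : modeBlock M 2 2 = modeBlock γ 2 2 + B) : (minorBlock M).det ≤ 0 := by
  have hd := h.det_eq_one
  -- Jacobi's identity for `γ` itself, with `det γ = 1` and `γ⁻¹ = -JγJ`.
  have h0 : (minorBlock γ).det = (modeBlock γ 0 1).det := by
    rw [← det_modeBlock_inv_mul_det (by rw [hd]; exact isUnit_one), hd, mul_one, h.inv_eq]
    simp only [modeBlock, det_fin_two, submatrix_apply, Matrix.neg_apply, Matrix.mul_apply,
      Fintype.sum_prod_type, Fin.sum_univ_three, Fin.sum_univ_two, sympJ_apply]
    simp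
    ring
  rw [minorBlock, h01, h02, h21, h22, det_fromBlocks_add]
  rw [minorBlock] at h0
  rw [h0]
  have h1 := trace_adjugate_mul_nonpos hB h.coefficient_nonpos
  have h2 := hn 0 1 (by decide)
  nlinarith [hB.det_pos]

/-- A product of local positive matrices leaves the determinants of the blocks of the inverse
non-positive. -/
theorem det_modeBlock_inv_nonpos {γ M : CM3} (h : IsPureCM γ) (hn : NonposDets γ)
    {B : Fin 3 → Matrix (Fin 2) (Fin 2) ℝ} (hB : ∀ x, (B x).PosDef) (hM : M.PosDef)
    (hoff : ∀ i j, i ≠ j → modeBlock M i j = modeBlock γ i j)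
    (hdiag : ∀ i, modeBlock M i i = modeBlock γ i i + B i) {i j : Fin 3} (hij : i ≠ j) :
    (modeBlock M⁻¹ i j).det ≤ 0 := by
  obtain ⟨e, rfl, rfl⟩ := exists_perm_of_ne hij
  set σ := modePerm e with hσ
  have hblock : ∀ (A : CM3) a b, modeBlock (A.submatrix σ σ) a b = modeBlock A (e a) (e b) :=
    fun _ _ _ => rfl
  have hN : NonposDets (γ.submatrix σ σ) := fun a b hab => by
    rw [hblock]
    exact hn _ _ (e.injective.ne hab)
  have hMσ : (M.submatrix σ σ).PosDef := hM.submatrix σ.injective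
  have h1 : (minorBlock (M.submatrix σ σ)).det ≤ 0 := by
    refine minorBlock_det_nonpos (h.submatrix_modePerm e) hN (hB (e 2)) ?_ ?_ ?_ ?_
    · exact hoff _ _ (e.injective.ne (by decide))
    · exact hoff _ _ (e.injective.ne (by decide))
    · exact hoff _ _ (e.injective.ne (by decide))
    · exact hdiag _
  rw [← det_modeBlock_inv_mul_det hMσ.det_pos.ne'.isUnit, inv_submatrix_equiv, hblock] at h1
  by_contra! hlt
  linarith [mul_pos hlt hMσ.det_pos]

/-! ### Pure GLOCC preserve non-positive determinants. -/

theorem IsPureCM.det_modeBlock_nonpos {G : LocalCJ} (h : IsPureCM G) :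
    (modeBlock G 0 1).det ≤ 0 := by
  have h1 := h.sum_det_modeBlock 0
  rw [Fin.sum_univ_two] at h1
  linarith [h.one_le_det_modeBlock 0]

theorem modeBlock_portBlock_localSum (G : Fin 3 → LocalCJ) (a b : Fin 2) (i j : Fin 3) :
    modeBlock (portBlock (localSum G) a b) i j = if i = j then modeBlock (G i) a b else 0 := by
  ext q r
  by_cases hij : i = j <;> simp [modeBlock, portBlock, localSum_apply, hij]

theorem modeBlock_mul {M : Type*} [Fintype M] (A B : Matrix (M × Fin 2) (M × Fin 2) ℝ)
    (i j : M) : modeBlock (A * B) i j = ∑ k, modeBlock A i k * modeBlock B k j := by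
  ext q r
  simp [modeBlock, Matrix.mul_apply, Fintype.sum_prod_type, Matrix.sum_apply]

theorem modeBlock_transpose {M : Type*} (A : Matrix (M × Fin 2) (M × Fin 2) ℝ) (i j : M) :
    modeBlock Aᵀ i j = (modeBlock A j i)ᵀ := rfl

theorem nonposDets_output {G : Fin 3 → LocalCJ} (hG : ∀ x, IsPureCM (G x)) {γ : CM3}
    (h : IsPureCM γ) (hn : NonposDets γ) : NonposDets (output (localSum G) γ) := by
  intro i j hij
  set g := Lam * γ * Lam with hg
  have hgp : IsPureCM g := h.Lam_mul_mul_Lam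
  have hgn : NonposDets g := fun a b hab => by
    -- Each block is multiplied by `σ_z` on both sides, and `(det σ_z)² = 1`.
    have e : (modeBlock g a b).det = (modeBlock γ a b).det := by
      simp [modeBlock, det_fin_two, hg, Lam_mul_mul_Lam_apply]
    rw [e]
    exact hn a b hab
  have hM := posDef_portBlock_add (isPureCM_localSum hG).1.posSemidef hgp.1
  have hinv : (modeBlock (portBlock (localSum G) 1 1 + g)⁻¹ i j).det ≤ 0 := by
    refine det_modeBlock_inv_nonpos hgp hgn (B := fun x => modeBlock (G x) 1 1)
      (fun x => (hG x).1.submatrix fun _ _ hpq => (Prod.mk.inj hpq).2) hM ?_ ?_ hij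
    · intro a b hab
      change modeBlock (portBlock (localSum G) 1 1) a b + modeBlock g a b = _
      rw [modeBlock_portBlock_localSum, if_neg hab, zero_add]
    · intro a
      change modeBlock (portBlock (localSum G) 1 1) a a + modeBlock g a a = _
      rw [modeBlock_portBlock_localSum, if_pos rfl, add_comm]
  have hout : modeBlock (output (localSum G) γ) i j =
      -(modeBlock (G i) 0 1 * modeBlock (portBlock (localSum G) 1 1 + g)⁻¹ i j *
        (modeBlock (G j) 0 1)ᵀ) := by
    change modeBlock (portBlock (localSum G) 0 0) i j - modeBlock (portBlock (localSum G) 0 1 *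
      (portBlock (localSum G) 1 1 + g)⁻¹ * (portBlock (localSum G) 0 1)ᵀ) i j = _
    rw [modeBlock_portBlock_localSum, if_neg hij, zero_sub, modeBlock_mul,
      Finset.sum_eq_single j _ (by simp), modeBlock_mul, Finset.sum_eq_single i _ (by simp),
      modeBlock_transpose, modeBlock_portBlock_localSum, modeBlock_portBlock_localSum, if_pos rfl,
      if_pos rfl]
    · intro b _ hb
      rw [modeBlock_portBlock_localSum, if_neg (Ne.symm hb), Matrix.zero_mul]
    · intro b _ hb
      rw [modeBlock_transpose, modeBlock_portBlock_localSum, if_neg (Ne.symm hb), transpose_zero,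
        Matrix.mul_zero]
  rw [hout, det_neg, det_mul, det_mul, det_transpose]
  have hCC := mul_nonneg_of_nonpos_of_nonpos (hG i).det_modeBlock_nonpos
    (hG j).det_modeBlock_nonpos
  simp only [Fintype.card_fin, even_two, Even.neg_pow, one_pow, one_mul]
  nlinarith

theorem isClosed_nonposDets : IsClosed {γ : CM3 | NonposDets γ} := by
  simp only [NonposDets, Set.ofPred_forall]
  refine isClosed_iInter fun i => isClosed_iInter fun j => isClosed_iInter fun _ => ?_
  refine isClosed_le ?_ continuous_const
  unfold modeBlock
  fun_prop

theorem PureReaches.nonposDets {γ γ' : CM3} (h : PureReaches γ γ') (hγ : IsPureCM γ)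
    (hn : NonposDets γ) : NonposDets γ' := by
  refine closure_minimal ?_ isClosed_nonposDets h
  rintro _ ⟨Γ, ⟨G, hG, rfl⟩, rfl⟩
  exact nonposDets_output hG hγ hn

/-! ### The symmetric and the distributed two-mode squeezed states. -/

theorem symEntry_bounds {l : ℝ} (hl : 1 ≤ l) :
    symEntry 1 l ≤ l ∧ 0 ≤ l + 2 * symEntry 1 l ∧ symEntry (-1) l ≤ l ∧
      0 ≤ l + 2 * symEntry (-1) l := by
  have h0 : 0 ≤ √(9 * l ^ 4 - 10 * l ^ 2 + 1) := Real.sqrt_nonneg _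
  have h1 : √(9 * l ^ 4 - 10 * l ^ 2 + 1) ≤ 3 * l ^ 2 - 1 := by
    apply Real.sqrt_le_iff.2
    constructor <;> nlinarith
  have hl2 : 1 ≤ l ^ 2 := by nlinarith
  have e : ∀ ε, symEntry ε l * (4 * l) = (l ^ 2 - 1) + ε * √(9 * l ^ 4 - 10 * l ^ 2 + 1) :=
    fun ε => by rw [symEntry, div_mul_cancel₀]; positivity
  have e1 := e 1
  have e2 := e (-1)
  refine ⟨?_, ?_, ?_, ?_⟩
  · by_contra! h
    nlinarith
  · have : 0 ≤ symEntry 1 l := by rw [symEntry]; apply div_nonneg <;> linarith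
    linarith
  · by_contra! h
    nlinarith
  · by_contra! h
    nlinarith

theorem symEntry_add {l : ℝ} (hl : 1 ≤ l) :
    l * (symEntry 1 l + symEntry (-1) l) = (l ^ 2 - 1) / 2 := by
  have : l ≠ 0 := by positivity
  rw [symEntry, symEntry]
  field_simp
  ring

theorem symEntry_mul {l : ℝ} (hl : 1 ≤ l) :
    symEntry 1 l * symEntry (-1) l = -(l ^ 2 - 1) / 2 := by
  have : l ≠ 0 := by positivity
  have hl2 : 1 ≤ l ^ 2 := by nlinarith
  have hs := Real.sq_sqrt (show 0 ≤ 9 * l ^ 4 - 10 * l ^ 2 + 1 by nlinarith)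
  rw [symEntry, symEntry]
  generalize √(9 * l ^ 4 - 10 * l ^ 2 + 1) = w at hs ⊢
  field_simp
  linear_combination -2 * hs

theorem symState_isHermitian (l : ℝ) : (symState l).IsHermitian := by
  ext ⟨i, q⟩ ⟨j, r⟩
  fin_cases i <;> fin_cases j <;> fin_cases q <;> fin_cases r <;> simp [symState]

/-- On each quadrature the eigenvalues are `l - d` and `l + 2d`. Purity amounts to `l² + 2d⁺d⁻ = 1`
and `l(d⁺ + d⁻) + d⁺d⁻ = 0`. -/
theorem isPureCM_symState {l : ℝ} (hl : 1 ≤ l) : IsPureCM (symState l) := by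
  obtain ⟨b1, b2, b3, b4⟩ := symEntry_bounds hl
  have ha := symEntry_add hl
  have hm := symEntry_mul hl
  refine isPureCM_iff.2 ⟨PosSemidef.of_dotProduct_mulVec_nonneg (symState_isHermitian l) ?_, ?_⟩
  · intro v
    have key : ∀ d x y z : ℝ, d ≤ l → 0 ≤ l + 2 * d →
        0 ≤ l * (x ^ 2 + y ^ 2 + z ^ 2) + 2 * d * (x * y + x * z + y * z) := by
      intro d x y z h1 h2
      have e : l * (x ^ 2 + y ^ 2 + z ^ 2) + 2 * d * (x * y + x * z + y * z) =
          ((l - d) * ((x - y) ^ 2 + (x - z) ^ 2 + (y - z) ^ 2) +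
            (l + 2 * d) * (x + y + z) ^ 2) / 3 := by ring
      rw [e]
      have := sub_nonneg.2 h1
      positivity
    have h0 := key _ (v (0, 0)) (v (1, 0)) (v (2, 0)) b1 b2
    have h1 := key _ (v (0, 1)) (v (1, 1)) (v (2, 1)) b3 b4
    refine (add_nonneg h0 h1).trans_eq ?_
    simp [dotProduct, mulVec, Fintype.sum_prod_type, Fin.sum_univ_three, symState]
    ring
  · ext ⟨i, q⟩ ⟨j, r⟩
    rw [mul_sympJ_mul_apply, Fin.sum_univ_three, sympJ_apply]
    fin_cases i <;> fin_cases j <;> fin_cases q <;> fin_cases r <;>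
      simp [symState] <;> linarith

theorem nonposDets_symState {l : ℝ} (hl : 1 ≤ l) : NonposDets (symState l) := by
  intro i j hij
  have e : (modeBlock (symState l) i j).det = symEntry 1 l * symEntry (-1) l := by
    fin_cases i <;> fin_cases j <;> first
      | exact absurd rfl hij
      | simp [modeBlock, det_fin_two, symState]
  rw [e, symEntry_mul hl]
  nlinarith

theorem isPureCM_tmsVacuum {s : ℝ} (hs : 0 < s) : IsPureCM (tmsVacuum s) := by
  have h1 := Real.cosh_sq s
  refine isPureCM_iff.2 ⟨PosSemidef.of_dotProduct_mulVec_nonneg ?_ fun v => ?_, ?_⟩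
  · ext ⟨i, q⟩ ⟨j, r⟩
    fin_cases i <;> fin_cases j <;> fin_cases q <;> fin_cases r <;> simp [tmsVacuum, sigmaZ]
  · have hc := (sub_pos.2 (Real.sinh_lt_cosh s)).le
    have hsh := (Real.sinh_pos_iff.2 hs).le
    have e : star v ⬝ᵥ tmsVacuum s *ᵥ v = (Real.cosh s - Real.sinh s) *
        (v (0, 0) ^ 2 + v (1, 0) ^ 2 + v (0, 1) ^ 2 + v (1, 1) ^ 2) +
        Real.sinh s * ((v (0, 0) + v (1, 0)) ^ 2 + (v (0, 1) - v (1, 1)) ^ 2) +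
        v (2, 0) ^ 2 + v (2, 1) ^ 2 := by
      simp [dotProduct, mulVec, Fintype.sum_prod_type, Fin.sum_univ_three, tmsVacuum, sigmaZ,
        -Real.cosh_sub_sinh]
      ring
    rw [e]
    positivity
  · ext ⟨i, q⟩ ⟨j, r⟩
    rw [mul_sympJ_mul_apply, Fin.sum_univ_three, sympJ_apply]
    fin_cases i <;> fin_cases j <;> fin_cases q <;> fin_cases r <;>
      simp [tmsVacuum, sigmaZ] <;> linarith

theorem isPureCM_distributedTMS {s : ℝ} (hs : 0 < s) (θ : ℝ) :
    IsPureCM (distributedTMS s θ) := by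
  have hT := isPureCM_tmsVacuum hs
  have hsc := Real.sin_sq_add_cos_sq θ
  set b : Matrix (Fin 3) (Fin 3) ℝ :=
    !![1, 0, 0; 0, Real.cos θ, Real.sin θ; 0, -Real.sin θ, Real.cos θ] with hb
  -- An orthogonal mixing of modes, the same on both quadratures, is symplectic.
  have hbb : bᵀ * b = 1 := by
    ext i j
    fin_cases i <;> fin_cases j <;> simp [hb, Matrix.mul_apply, Fin.sum_univ_three] <;> linarith
  have hB : (beamSplitter θ)ᵀ * sympJ (Fin 3) * beamSplitter θ = sympJ (Fin 3) := by
    rw [beamSplitter, sympJ, ← kroneckerMap_transpose, transpose_one, ← mul_kronecker_mul, ← mul_kronecker_mul,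
      Matrix.mul_one, hbb, Matrix.one_mul, Matrix.mul_one]
  have hB' : beamSplitter θ * sympJ (Fin 3) * (beamSplitter θ)ᵀ = sympJ (Fin 3) := by
    rw [beamSplitter, sympJ, ← kroneckerMap_transpose, transpose_one, ← mul_kronecker_mul, ← mul_kronecker_mul,
      Matrix.mul_one, mul_eq_one_comm.1 hbb, Matrix.one_mul, Matrix.mul_one]
  rw [distributedTMS]
  refine isPureCM_iff.2 ⟨by simpa using hT.1.posSemidef.mul_mul_conjTranspose_same _, ?_⟩
  calc _ = beamSplitter θ * (tmsVacuum s * ((beamSplitter θ)ᵀ * sympJ (Fin 3) * beamSplitter θ) *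
        tmsVacuum s) * (beamSplitter θ)ᵀ := by simp only [Matrix.mul_assoc]
    _ = _ := by rw [hB, hT.mul_sympJ_mul, hB']

theorem det_modeBlock_distributedTMS (s θ : ℝ) :
    (modeBlock (distributedTMS s θ) 1 2).det =
      (Real.sin θ * Real.cos θ * (1 - Real.cosh s)) ^ 2 := by
  simp [modeBlock, det_fin_two, distributedTMS, beamSplitter, tmsVacuum, sigmaZ, Matrix.mul_apply,
    Fintype.sum_prod_type, Fin.sum_univ_three]
  ring

end GLOCC

theorem mainTheorem6 :
    -- from a pure state whose three determinants are non-positive, no positive one arises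
    (∀ γ : GLOCC.CM3, GLOCC.IsPureCM γ → GLOCC.NonposDets γ →
      (∀ γ' : GLOCC.CM3, GLOCC.PureReaches γ γ' → GLOCC.NonposDets γ') ∧
      (∀ γ' : GLOCC.CM3, GLOCC.Reaches γ γ' → GLOCC.IsPureCM γ' → GLOCC.NonposDets γ')) ∧
    -- no symmetric state reaches a distributed two-mode squeezed state
    (∀ s θ : ℝ, 0 < s → Real.sin θ * Real.cos θ ≠ 0 →
      GLOCC.IsPureCM (GLOCC.distributedTMS s θ) ∧
      ∀ l : ℝ, 1 ≤ l → ¬ GLOCC.Reaches (GLOCC.symState l) (GLOCC.distributedTMS s θ)) := by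
  refine ⟨fun γ hγ hn => ⟨fun γ' h => h.nonposDets hγ hn,
    fun γ' h hγ' => (h.pureReaches hγ hγ').nonposDets hγ hn⟩, fun s θ hs hθ =>
    ⟨GLOCC.isPureCM_distributedTMS hs θ, fun l hl h => ?_⟩⟩
  have hp := GLOCC.isPureCM_symState hl
  have hn := (h.pureReaches hp (GLOCC.isPureCM_distributedTMS hs θ)).nonposDets hp
    (GLOCC.nonposDets_symState hl) 1 2 (by decide)
  rw [GLOCC.det_modeBlock_distributedTMS] at hn
  have hc : 1 - Real.cosh s ≠ 0 := (sub_neg.2 (Real.one_lt_cosh.2 hs.ne')).ne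
  have := pow_pos (abs_pos.2 (mul_ne_zero hθ hc)) 2
  rw [sq_abs] at this
  linarith
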